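/- Let $N\ge 0$ be an integer, $B,C,T>0$, let $\varphi:[0,\infty)\to\mathbb R$ have $N+1$ continuous derivatives on $[0,\infty)$, and let $G(x)>0$ be a function such that $$|\varphi^{(N+1)}(x)|\le \frac{G(x)}{x^{N+1}}\quad (x\ge T),\qquad G(y)\le B\,G(x)\,e^{C|y-x|/\sqrt x}\quad (x,y\ge T).$$ Let the Mahler polynomials $\rho_j$ be defined by the generating function $e^{-x(e^z-1-z)}=\sum_{j\ge 0}\frac{\rho_j(x)}{j!}z^j$. Then the series $\sum_{m\ge 0}\frac{\varphi(m)}{m!}R^m$ converges absolutely for all real $R$, and, as $R\to+\infty$, $$e^{-R}\sum_{m=0}^\infty\frac{\varphi(m)}{m!}R^m=\sum_{j=0}^N\frac{\varphi^{(j)}(R)}{j!}\,\rho_j(-R)+O\!\left(R^{-\frac{N+1}{2}}G(R)\right)+O\!\left(R^{T+\frac{N+1}{2}}e^{-R}\right).$$ The implied constants depend only on $N$, $B$ and $C$ (the threshold beyond which the estimate holds may depend on all the data). Alternatively, the estimate holds for all $R\ge R_0$ with $R_0$ depending only on $N,B,C,T$, the constant in the first error term depending only on $N,B,C$, if the constant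 in the second error term is allowed to depend on all the data, $\varphi$ included. Moreover, for every $j\ge0$ the polynomial $\rho_j(-x)$ has degree $\lfloor j/2\rfloor$ in $x$ (the zero polynomial $\rho_1$ being counted as of degree $0$) and nonnegative coefficients, and the polynomials $\rho_0(-x),\dots,\rho_7(-x)$ are $$1,\quad 0,\quad x,\quad x,\quad 3x^2+x,\quad 10x^2+x,\quad 15x^3+25x^2+x,\quad 105x^3+56x^2+x.$$ -/

import Mathlib

noncomputable section

/-- The exponent `-x (e^z - 1 - z)`, as a formal power series in `z` over `ℝ[x]`. -/
def mahlerExponent : PowerSeries (Polynomial ℝ) :=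
  -(PowerSeries.C (Polynomial.X : Polynomial ℝ)) *
    (PowerSeries.exp (Polynomial ℝ) - 1 - PowerSeries.X)

/-- The exponent has no constant term, so it may be substituted into the exponential series. -/
theorem mahlerExponent_hasSubst : PowerSeries.HasSubst mahlerExponent :=
  PowerSeries.HasSubst.of_constantCoeff_zero' (by simp [mahlerExponent])

/-- The Mahler polynomials `ρ_j`, defined by `e^{-x (e^z - 1 - z)} = ∑ ρ_j(x) z^j / j!`. -/
def mahlerPolynomial (j : ℕ) : Polynomial ℝ :=
  Polynomial.C (j.factorial : ℝ) *
    PowerSeries.coeff j ((PowerSeries.exp (Polynomial ℝ)).subst mahlerExponent)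

/-- `e^{-R} ∑_{m ≥ 0} φ(m) R^m / m!`, the mean of `φ` at a Poisson variable of parameter `R`. -/
def poissonMean (φ : ℝ → ℝ) (R : ℝ) : ℝ :=
  Real.exp (-R) * ∑' m : ℕ, φ m / (m.factorial : ℝ) * R ^ m

/-- `∑_{j ≤ N} φ^{(j)}(R) ρ_j(-R) / j!`, with the derivatives of `φ` taken on `[0, ∞)`. -/
def mahlerSum (φ : ℝ → ℝ) (N : ℕ) (R : ℝ) : ℝ :=
  ∑ j ∈ Finset.range (N + 1),
    iteratedDerivWithin j φ (Set.Ici 0) R / (j.factorial : ℝ) * (mahlerPolynomial j).eval (-R)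

end

/-! Let X be a Poisson variable of mean R. Expand φ(X) by Taylor's formula at R and take
expectations. The central moments E(X - R)^j obey the same recurrence as ρ_j(-R), so the Taylor
polynomial averages exactly to `mahlerSum`, and only the mean of the remainder has to be estimated.

Put u = |X - R|/√R. The hypotheses on G bound the remainder by a constant times R^{-(N+1)/2} G(R)
e^{(C+1)u}, uniformly in X ≥ T (`abs_sub_taylorWithinEval_le`). The exponential moments of u are
bounded independently of R (`poissonWeight_mul_exp_abs_sub`), which gives the first error term. When
X < T, nothing is known of φ beyond continuity of its derivatives, and an extra bounded term
appears. It is weighted by P(X < T) = O(R^T e^{-R}), whence the second error term. -/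

/-! ### Mahler polynomials: recurrence, degree, positivity, first values. -/

theorem coeff_mahlerExponent_derivative (b : ℕ) :
    PowerSeries.coeff b (PowerSeries.derivative (Polynomial ℝ) mahlerExponent) =
      if b = 0 then 0 else -Polynomial.X * Polynomial.C ((b.factorial : ℝ)⁻¹) := by
  have hexp : PowerSeries.coeff (b + 1) (PowerSeries.exp (Polynomial ℝ)) =
      Polynomial.C (((b + 1).factorial : ℝ)⁻¹) := by
    rw [PowerSeries.coeff_exp, IsScalarTower.algebraMap_apply ℚ ℝ (Polynomial ℝ),
      Polynomial.algebraMap_eq]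
    simp
  rw [PowerSeries.coeff_derivative, mahlerExponent, neg_mul, map_neg, PowerSeries.coeff_C_mul,
    map_sub, map_sub, hexp, PowerSeries.coeff_one, PowerSeries.coeff_X]
  rcases eq_or_ne b 0 with rfl | hb
  · simp
  · have h5 : ((b + 1).factorial : ℝ)⁻¹ * ((b : ℝ) + 1) = (b.factorial : ℝ)⁻¹ := by
      have := Nat.factorial_ne_zero b
      rw [Nat.factorial_succ]
      push_cast
      field_simp
    rw [if_neg (by omega), if_neg (by omega), if_neg hb, ← h5]
    simp only [map_mul, map_add, map_one, map_natCast]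
    ring

theorem mahlerPolynomial_zero : mahlerPolynomial 0 = 1 := by
  have h : PowerSeries.coeff 0
      ((PowerSeries.exp (Polynomial ℝ)).subst mahlerExponent) = 1 := by
    rw [PowerSeries.coeff_subst' mahlerExponent_hasSubst, finsum_eq_single _ 0]
    · simp
    · intro d hd
      simp [mahlerExponent, hd]
  simp [mahlerPolynomial, h]

/-- The recurrence read off from `F' = -x (e^z - 1) F`. -/
theorem mahlerPolynomial_succ (n : ℕ) :
    mahlerPolynomial (n + 1) = -Polynomial.X *
      ∑ i ∈ Finset.range n, Polynomial.C (n.choose i : ℝ) * mahlerPolynomial i := by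
  have h1 := congrArg (PowerSeries.coeff n)
    (PowerSeries.derivative_subst (f := PowerSeries.exp (Polynomial ℝ)) mahlerExponent_hasSubst)
  rw [PowerSeries.derivative_exp, PowerSeries.coeff_derivative, PowerSeries.coeff_mul,
    Finset.Nat.sum_antidiagonal_eq_sum_range_succ_mk, Finset.sum_range_succ] at h1
  -- The term i = n drops out because e^z - 1 has no constant term. The recurrence thus skips from n
  -- + 1 to indices below n, which is why the degree grows only like j/2.
  simp only [coeff_mahlerExponent_derivative, Nat.sub_self, if_true, mul_zero, add_zero] at h1
  have h2 : mahlerPolynomial (n + 1) = Polynomial.C (n.factorial : ℝ) *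
      (PowerSeries.coeff (n + 1) ((PowerSeries.exp (Polynomial ℝ)).subst mahlerExponent) *
        ((n : Polynomial ℝ) + 1)) := by
    rw [mahlerPolynomial, Nat.factorial_succ]
    push_cast
    simp only [map_mul, map_add, map_one, map_natCast]
    ring
  rw [h2, h1, Finset.mul_sum, Finset.mul_sum]
  refine Finset.sum_congr rfl fun i hi => ?_
  have hi' := Finset.mem_range.1 hi
  rw [if_neg (by omega), mahlerPolynomial, Nat.cast_choose ℝ hi'.le]
  have h3 : (n.factorial : ℝ) * ((n - i).factorial : ℝ)⁻¹ =
      (n.factorial : ℝ) / (i.factorial * (n - i).factorial) * i.factorial := by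
    have := Nat.factorial_ne_zero i
    have := Nat.factorial_ne_zero (n - i)
    field_simp
  have h4 := congrArg Polynomial.C h3
  simp only [map_mul] at h4 ⊢
  linear_combination (-Polynomial.X *
    PowerSeries.coeff i ((PowerSeries.exp (Polynomial ℝ)).subst mahlerExponent)) * h4

theorem mahlerPolynomial_comp_zero :
    (mahlerPolynomial 0).comp (-Polynomial.X) = 1 := by
  simp [mahlerPolynomial_zero]

theorem mahlerPolynomial_comp_succ (n : ℕ) :
    (mahlerPolynomial (n + 1)).comp (-Polynomial.X) = Polynomial.X *
      ∑ i ∈ Finset.range n,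
        Polynomial.C (n.choose i : ℝ) * (mahlerPolynomial i).comp (-Polynomial.X) := by
  simp [mahlerPolynomial_succ]

theorem mahlerPolynomial_eval_neg_succ (n : ℕ) (x : ℝ) :
    (mahlerPolynomial (n + 1)).eval (-x) = x *
      ∑ i ∈ Finset.range n, (n.choose i : ℝ) * (mahlerPolynomial i).eval (-x) := by
  simp [mahlerPolynomial_succ, Polynomial.eval_finsetSum]

theorem mahlerPolynomial_comp_coeff_nonneg (j : ℕ) :
    ∀ i : ℕ, 0 ≤ ((mahlerPolynomial j).comp (-Polynomial.X)).coeff i := by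
  induction j using Nat.strong_induction_on with
  | _ j ih =>
    intro i
    rcases j with _ | n
    · rw [mahlerPolynomial_comp_zero, Polynomial.coeff_one]
      split_ifs <;> norm_num
    · rw [mahlerPolynomial_comp_succ]
      rcases i with _ | i
      · simp
      · rw [Polynomial.coeff_X_mul, Polynomial.finsetSum_coeff]
        refine Finset.sum_nonneg fun k hk => ?_
        rw [Polynomial.coeff_C_mul]
        exact mul_nonneg (Nat.cast_nonneg _) (ih k (by have := Finset.mem_range.1 hk; omega) i)

theorem mahlerPolynomial_comp_natDegree_le (j : ℕ) :
    ((mahlerPolynomial j).comp (-Polynomial.X)).natDegree ≤ j / 2 := by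
  induction j using Nat.strong_induction_on with
  | _ j ih =>
    rcases j with _ | n
    · simp [mahlerPolynomial_comp_zero]
    · rw [mahlerPolynomial_comp_succ]
      rcases n with _ | n
      · simp
      · have h : (∑ i ∈ Finset.range (n + 1), Polynomial.C ((n + 1).choose i : ℝ) *
            (mahlerPolynomial i).comp (-Polynomial.X)).natDegree ≤ n / 2 := by
          refine Polynomial.natDegree_sum_le_of_forall_le _ _ fun i hi => ?_
          have hi' := Finset.mem_range.1 hi
          exact (Polynomial.natDegree_C_mul_le _ _).trans
            ((ih i (by omega)).trans (Nat.div_le_div_right (by omega)))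
        refine Polynomial.natDegree_mul_le.trans ?_
        rw [Polynomial.natDegree_X]
        omega

/-- Nonnegative coefficients cannot cancel, so one positive contribution to the top coefficient is
enough. -/
theorem mahlerPolynomial_comp_coeff_pos (j : ℕ) (hj : j ≠ 1) :
    0 < ((mahlerPolynomial j).comp (-Polynomial.X)).coeff (j / 2) := by
  induction j using Nat.strong_induction_on with
  | _ j ih =>
    rcases j with _ | _ | n
    · simp [mahlerPolynomial_comp_zero]
    · exact absurd rfl hj
    · rw [mahlerPolynomial_comp_succ, show (n + 1 + 1) / 2 = n / 2 + 1 by omega,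
        Polynomial.coeff_X_mul, Polynomial.finsetSum_coeff]
      have hterm : ∀ k, 0 ≤ (Polynomial.C ((n + 1).choose k : ℝ) *
          (mahlerPolynomial k).comp (-Polynomial.X)).coeff (n / 2) := fun k => by
        rw [Polynomial.coeff_C_mul]
        exact mul_nonneg (Nat.cast_nonneg _) (mahlerPolynomial_comp_coeff_nonneg k _)
      refine Finset.sum_pos' (fun k _ => hterm k) ?_
      -- Index n normally supplies the top coefficient of index n + 2. Since ρ_1 = 0, index 3 must
      -- take it from ρ_0.
      by_cases hn : n = 1
      · subst hn
        exact ⟨0, by simp, by simp [mahlerPolynomial_comp_zero]⟩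
      · refine ⟨n, by simp, ?_⟩
        rw [Polynomial.coeff_C_mul]
        exact mul_pos (Nat.cast_pos.2 (Nat.choose_pos (by omega))) (ih n (by omega) hn)

theorem mahlerPolynomial_comp_natDegree (j : ℕ) :
    ((mahlerPolynomial j).comp (-Polynomial.X)).natDegree = j / 2 := by
  by_cases hj : j = 1
  · subst hj
    simp [mahlerPolynomial_comp_succ]
  · exact le_antisymm (mahlerPolynomial_comp_natDegree_le j)
      (Polynomial.le_natDegree_of_ne_zero (mahlerPolynomial_comp_coeff_pos j hj).ne')

theorem mahlerPolynomial_eval_neg_values (x : ℝ) :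
    (mahlerPolynomial 0).eval (-x) = 1 ∧
    (mahlerPolynomial 1).eval (-x) = 0 ∧
    (mahlerPolynomial 2).eval (-x) = x ∧
    (mahlerPolynomial 3).eval (-x) = x ∧
    (mahlerPolynomial 4).eval (-x) = 3 * x ^ 2 + x ∧
    (mahlerPolynomial 5).eval (-x) = 10 * x ^ 2 + x ∧
    (mahlerPolynomial 6).eval (-x) = 15 * x ^ 3 + 25 * x ^ 2 + x ∧
    (mahlerPolynomial 7).eval (-x) = 105 * x ^ 3 + 56 * x ^ 2 + x := by
  have h0 : (mahlerPolynomial 0).eval (-x) = 1 := by simp [mahlerPolynomial_zero]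
  have h1 : (mahlerPolynomial 1).eval (-x) = 0 := by simp [mahlerPolynomial_eval_neg_succ]
  have h2 : (mahlerPolynomial 2).eval (-x) = x := by
    simp [mahlerPolynomial_eval_neg_succ 1, h0]
  have h3 : (mahlerPolynomial 3).eval (-x) = x := by
    simp [mahlerPolynomial_eval_neg_succ 2, Finset.sum_range_succ, h0, h1]
  have h4 : (mahlerPolynomial 4).eval (-x) = 3 * x ^ 2 + x := by
    simp [mahlerPolynomial_eval_neg_succ 3, Finset.sum_range_succ, Nat.choose, h0, h1, h2]
    ring
  have h5 : (mahlerPolynomial 5).eval (-x) = 10 * x ^ 2 + x := by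
    simp [mahlerPolynomial_eval_neg_succ 4, Finset.sum_range_succ, Nat.choose, h0, h1, h2, h3]
    ring
  have h6 : (mahlerPolynomial 6).eval (-x) = 15 * x ^ 3 + 25 * x ^ 2 + x := by
    simp [mahlerPolynomial_eval_neg_succ 5, Finset.sum_range_succ, Nat.choose, h0, h1, h2, h3, h4]
    ring
  have h7 : (mahlerPolynomial 7).eval (-x) = 105 * x ^ 3 + 56 * x ^ 2 + x := by
    simp [mahlerPolynomial_eval_neg_succ 6, Finset.sum_range_succ, Nat.choose, h0, h1, h2, h3, h4,
      h5]
    ring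
  exact ⟨h0, h1, h2, h3, h4, h5, h6, h7⟩

/-! ### Poisson weights: central moments, exponential moments, lower tail. -/

theorem HasSum.of_eq_of_eq {f g : ℕ → ℝ} {a b : ℝ} (h : HasSum f a) (hfg : ∀ m, g m = f m)
    (hab : b = a) : HasSum g b := by
  rw [hab, funext hfg]
  exact h

/-- The probability that a Poisson variable of parameter `R` takes the value `m`. -/
noncomputable def poissonWeight (R : ℝ) (m : ℕ) : ℝ :=
  Real.exp (-R) * (R ^ m / (m.factorial : ℝ))

theorem poissonWeight_nonneg {R : ℝ} (hR : 0 ≤ R) (m : ℕ) : 0 ≤ poissonWeight R m := by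
  unfold poissonWeight
  positivity

theorem poissonWeight_succ (R : ℝ) (m : ℕ) :
    poissonWeight R (m + 1) * ((m : ℝ) + 1) = R * poissonWeight R m := by
  have := Nat.factorial_ne_zero m
  rw [poissonWeight, poissonWeight, Nat.factorial_succ, pow_succ]
  push_cast
  field_simp

theorem hasSum_poissonWeight_mul_exp (R s : ℝ) :
    HasSum (fun m : ℕ => poissonWeight R m * Real.exp (s * m))
      (Real.exp (R * (Real.exp s - 1))) := by
  have h := (NormedSpace.expSeries_div_hasSum_exp (R * Real.exp s)).mul_left (Real.exp (-R))
  rw [← Real.exp_eq_exp_ℝ, ← Real.exp_add] at h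
  refine h.of_eq_of_eq (fun m => ?_) ?_
  · rw [poissonWeight, mul_pow, ← Real.exp_nat_mul, mul_comm s]
    ring
  · congr 1
    ring

theorem summable_of_abs_le_mul_pow {f : ℕ → ℝ} {A a : ℝ} (hf : ∀ m, |f m| ≤ A * a ^ m) (R : ℝ) :
    Summable fun m : ℕ => f m / (m.factorial : ℝ) * R ^ m := by
  refine Summable.of_norm_bounded ((Real.summable_pow_div_factorial (a * |R|)).mul_left A)
    fun m => ?_
  rw [Real.norm_eq_abs, abs_mul, abs_div, Nat.abs_cast, abs_pow, mul_pow]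
  calc |f m| / m.factorial * |R| ^ m ≤ (A * a ^ m) / m.factorial * |R| ^ m := by gcongr; exact hf m
    _ = _ := by ring

theorem summable_poissonWeight_mul {f : ℕ → ℝ} {R : ℝ}
    (hf : Summable fun m : ℕ => f m / (m.factorial : ℝ) * R ^ m) :
    Summable fun m => poissonWeight R m * f m := by
  refine (hf.mul_left (Real.exp (-R))).congr fun m => ?_
  rw [poissonWeight]
  ring

theorem poissonMean_eq_tsum (φ : ℝ → ℝ) (R : ℝ) :
    poissonMean φ R = ∑' m : ℕ, poissonWeight R m * φ m := by
  rw [poissonMean, ← tsum_mul_left]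
  refine tsum_congr fun m => ?_
  rw [poissonWeight]
  ring

theorem pow_le_factorial_mul_exp {x : ℝ} (hx : 0 ≤ x) (n : ℕ) :
    x ^ n ≤ n.factorial * Real.exp x := by
  have h := Real.pow_div_factorial_le_exp x hx n
  rwa [div_le_iff₀' (by positivity)] at h

/-- The identity E[X f(X)] = R E[f(X + 1)] with f(x) = (x - R)^n, followed by the binomial expansion
of (X - R + 1)^n. Subtracting R E(X - R)^n cancels the term i = n, which leaves the recurrence of
`mahlerPolynomial_succ`. -/
theorem hasSum_poissonWeight_mul_sub_pow_succ (R : ℝ) (n : ℕ) {c : ℕ → ℝ}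
    (hc : ∀ i < n + 1, HasSum (fun m : ℕ => poissonWeight R m * ((m : ℝ) - R) ^ i) (c i)) :
    HasSum (fun m : ℕ => poissonWeight R m * ((m : ℝ) - R) ^ (n + 1))
      (R * ∑ i ∈ Finset.range n, (n.choose i : ℝ) * c i) := by
  have h1 : HasSum (fun m : ℕ => poissonWeight R m * ((m : ℝ) + 1 - R) ^ n)
      (∑ i ∈ Finset.range (n + 1), (n.choose i : ℝ) * c i) := by
    have h := hasSum_sum (s := Finset.range (n + 1)) (f := fun i (m : ℕ) =>
      (n.choose i : ℝ) * (poissonWeight R m * ((m : ℝ) - R) ^ i))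
      (fun i hi => (hc i (Finset.mem_range.1 hi)).mul_left (n.choose i : ℝ))
    refine h.of_eq_of_eq (fun m => ?_) rfl
    rw [show (m : ℝ) + 1 - R = ((m : ℝ) - R) + 1 by ring, add_pow, Finset.mul_sum]
    refine Finset.sum_congr rfl fun i _ => ?_
    rw [one_pow]
    ring
  have h2 : HasSum (fun m : ℕ => poissonWeight R m * ((m : ℝ) * ((m : ℝ) - R) ^ n))
      (R * ∑ i ∈ Finset.range (n + 1), (n.choose i : ℝ) * c i) := by
    rw [← hasSum_nat_add_iff' 1]
    simp only [Finset.range_one, Finset.sum_singleton, Nat.cast_zero, zero_mul, mul_zero, sub_zero]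
    refine (h1.mul_left R).of_eq_of_eq (fun m => ?_) rfl
    push_cast
    rw [← mul_assoc, ← mul_assoc, poissonWeight_succ]
  have h3 := h2.sub ((hc n (Nat.lt_succ_self n)).mul_left R)
  rw [Finset.sum_range_succ] at h3
  refine h3.of_eq_of_eq (fun m => by ring) ?_
  rw [Nat.choose_self]
  push_cast
  ring

/-- The central moments of the Poisson distribution. -/
theorem hasSum_poissonWeight_mul_sub_pow (R : ℝ) (j : ℕ) :
    HasSum (fun m : ℕ => poissonWeight R m * ((m : ℝ) - R) ^ j)
      ((mahlerPolynomial j).eval (-R)) := by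
  induction j using Nat.strong_induction_on with
  | _ j ih =>
    rcases j with _ | n
    · simpa [mahlerPolynomial_zero] using hasSum_poissonWeight_mul_exp R 0
    · rw [mahlerPolynomial_eval_neg_succ]
      exact hasSum_poissonWeight_mul_sub_pow_succ R n ih

/-- Exponential moments of the normalised deviation `|m - R| / √R` are bounded. -/
theorem poissonWeight_mul_exp_abs_sub {c R : ℝ} (hc : 0 ≤ c) (hR : 0 < R) (hcR : c ^ 2 ≤ R) :
    Summable (fun m : ℕ => poissonWeight R m * Real.exp (c * (|(m : ℝ) - R| / √R))) ∧
    ∑' m : ℕ, poissonWeight R m * Real.exp (c * (|(m : ℝ) - R| / √R)) ≤ 2 * Real.exp (c ^ 2) := by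
  have hs : 0 < √R := Real.sqrt_pos.2 hR
  -- E e^{t(X-R)} = exp(R(e^t - 1 - t)) ≤ exp(R t²) for |t| ≤ 1; the condition c² ≤ R ensures |t| ≤
  -- 1. Both signs of t are needed, as e^{|v|} ≤ e^v + e^{-v}; hence the factor 2.
  have key : ∀ t : ℝ, |t| = c / √R →
      HasSum (fun m : ℕ => poissonWeight R m * Real.exp (t * ((m : ℝ) - R)))
        (Real.exp (R * (Real.exp t - 1 - t))) ∧
      Real.exp (R * (Real.exp t - 1 - t)) ≤ Real.exp (c ^ 2) := by
    intro t ht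
    constructor
    · refine ((hasSum_poissonWeight_mul_exp R t).mul_right
        (Real.exp (-(t * R)))).of_eq_of_eq (fun m => ?_) ?_
      · rw [mul_assoc, ← Real.exp_add]
        ring_nf
      · rw [← Real.exp_add]
        ring_nf
    · have h1 : |t| ≤ 1 := by
        rw [ht, div_le_one hs]
        exact Real.le_sqrt_of_sq_le hcR
      have h2 := (le_abs_self _).trans (Real.abs_exp_sub_one_sub_id_le h1)
      have h3 : R * t ^ 2 = c ^ 2 := by
        rw [← sq_abs, ht, div_pow, Real.sq_sqrt hR.le]
        field_simp
      rw [Real.exp_le_exp, ← h3]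
      gcongr
  obtain ⟨hp, hp'⟩ := key (c / √R) (abs_of_nonneg (by positivity))
  obtain ⟨hm, hm'⟩ := key (-(c / √R)) (by rw [abs_neg, abs_of_nonneg (by positivity)])
  have hle : ∀ m : ℕ, poissonWeight R m * Real.exp (c * (|(m : ℝ) - R| / √R)) ≤
      poissonWeight R m * Real.exp (c / √R * ((m : ℝ) - R)) +
        poissonWeight R m * Real.exp (-(c / √R) * ((m : ℝ) - R)) := by
    intro m
    rw [← mul_add]
    refine mul_le_mul_of_nonneg_left ?_ (poissonWeight_nonneg hR.le m)
    rcases abs_cases ((m : ℝ) - R) with ⟨h, -⟩ | ⟨h, -⟩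
    · rw [h, show c * (((m : ℝ) - R) / √R) = c / √R * ((m : ℝ) - R) by ring]
      linarith [Real.exp_pos (-(c / √R) * ((m : ℝ) - R))]
    · rw [h, show c * (-((m : ℝ) - R) / √R) = -(c / √R) * ((m : ℝ) - R) by ring]
      linarith [Real.exp_pos (c / √R * ((m : ℝ) - R))]
  have hsum : Summable (fun m : ℕ => poissonWeight R m * Real.exp (c * (|(m : ℝ) - R| / √R))) :=
    Summable.of_nonneg_of_le
      (fun m => mul_nonneg (poissonWeight_nonneg hR.le m) (Real.exp_pos _).le) hle
      (hp.add hm).summable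
  refine ⟨hsum, (hsum.tsum_le_tsum hle (hp.add hm).summable).trans ?_⟩
  rw [(hp.add hm).tsum_eq]
  linarith

theorem sum_poissonWeight_range_le {R T : ℝ} (hR : 1 ≤ R) :
    ∑ m ∈ Finset.range ⌈T⌉₊, poissonWeight R m ≤ ⌈T⌉₊ * (R ^ T * Real.exp (-R)) := by
  rw [← nsmul_eq_mul]
  refine (Finset.sum_le_card_nsmul _ _ (R ^ T * Real.exp (-R)) fun m hm => ?_).trans
    (by rw [Finset.card_range])
  have hm' : (m : ℝ) < T := Nat.lt_ceil.1 (Finset.mem_range.1 hm)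
  rw [poissonWeight, mul_comm]
  gcongr
  calc R ^ m / (m.factorial : ℝ) ≤ R ^ m :=
        div_le_self (by positivity) (by exact_mod_cast Nat.one_le_iff_ne_zero.2 m.factorial_ne_zero)
    _ = R ^ (m : ℝ) := (Real.rpow_natCast R m).symm
    _ ≤ R ^ T := Real.rpow_le_rpow_of_exponent_le hR hm'.le

/-! ### Taylor remainder and growth of φ. -/

-- Differentiating the Taylor polynomial at b in its base point t telescopes to a single term. The
-- integral is oriented, so b may lie on either side of a.
open Set in
theorem sub_taylorWithinEval_eq_integral {φ : ℝ → ℝ} {N : ℕ} {a b : ℝ}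
    (hφ : ContDiffOn ℝ ((N + 1 : ℕ) : WithTop ℕ∞) φ (Ici 0)) (ha : 0 ≤ a) (hb : 0 ≤ b) :
    φ b - taylorWithinEval φ N (Ici 0) a b =
      ∫ t in a..b, ((N.factorial : ℝ)⁻¹ * (b - t) ^ N) * iteratedDerivWithin (N + 1) φ (Ici 0) t := by
  have hN : ContDiffOn ℝ N φ (Ici 0) := hφ.of_le (by exact_mod_cast Nat.le_succ N)
  have hsub : uIcc a b ⊆ Ici (0 : ℝ) := fun t ht => (le_min ha hb).trans ht.1
  have hcont := hφ.continuousOn_iteratedDerivWithin (m := N + 1) (by norm_cast)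
    (uniqueDiffOn_Ici 0)
  rw [intervalIntegral.integral_eq_sub_of_hasDeriv_right
    (f := fun t => taylorWithinEval φ N (Ici 0) t b), taylorWithinEval_self]
  · exact (continuousOn_taylorWithinEval (uniqueDiffOn_Ici 0) hN).mono hsub
  · intro t ht
    -- Only interior points are differentiated at, so an endpoint equal to 0 does no harm.
    have ht0 : 0 < t := (le_min ha hb).trans_lt ht.1
    have hd : DifferentiableWithinAt ℝ (iteratedDerivWithin N φ (Ici 0)) (Ici 0) t :=
      hφ.differentiableOn_iteratedDerivWithin (by exact_mod_cast Nat.lt_succ_self N)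
        (uniqueDiffOn_Ici 0) t ht0.le
    have h := hasDerivWithinAt_taylorWithinEval (x := b) (uniqueDiffOn_Ici 0)
      self_mem_nhdsWithin (mem_Ici.2 ht0.le) subset_rfl hN hd
    simp only [smul_eq_mul] at h
    exact h.mono fun x hx => ht0.le.trans (le_of_lt hx)
  · refine ContinuousOn.intervalIntegrable (ContinuousOn.mul (by fun_prop) (hcont.mono hsub))

open Set in
theorem abs_integral_taylor_kernel_le {ψ : ℝ → ℝ} {N : ℕ} {b c d D L : ℝ}
    (hψ : ∀ t ∈ uIcc c d, |ψ t| ≤ D) (hL : ∀ t ∈ uIcc c d, |b - t| ≤ L) :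
    |∫ t in c..d, ((N.factorial : ℝ)⁻¹ * (b - t) ^ N) * ψ t| ≤ D * L ^ N * |d - c| := by
  rw [← Real.norm_eq_abs]
  refine intervalIntegral.norm_integral_le_of_norm_le_const fun t ht => ?_
  have ht' := uIoc_subset_uIcc ht
  have hN : (N.factorial : ℝ)⁻¹ ≤ 1 :=
    inv_le_one_of_one_le₀ (by exact_mod_cast Nat.one_le_iff_ne_zero.2 N.factorial_ne_zero)
  have hpow : |b - t| ^ N ≤ L ^ N := pow_le_pow_left₀ (abs_nonneg _) (hL t ht') N
  have hL0 : 0 ≤ L ^ N := (pow_nonneg (abs_nonneg _) N).trans hpow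
  rw [Real.norm_eq_abs, abs_mul, abs_mul, abs_pow, abs_of_nonneg (by positivity), mul_comm D]
  refine mul_le_mul ?_ (hψ t ht') (abs_nonneg _) hL0
  calc (N.factorial : ℝ)⁻¹ * |b - t| ^ N ≤ 1 * L ^ N := by gcongr
    _ = L ^ N := one_mul _

-- Geometric growth of φ(m), needed for convergence of the series. Taylor's formula at the fixed
-- point T makes the growth hypothesis on G read e^{Cm/√T}, and e^m absorbs the powers of m.
open Set in
theorem exists_abs_le_mul_pow {φ G : ℝ → ℝ} {N : ℕ} {B C T : ℝ} (hB : 0 < B) (hC : 0 < C)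
    (hT : 0 < T) (hφ : ContDiffOn ℝ ((N + 1 : ℕ) : WithTop ℕ∞) φ (Ici 0))
    (hG : ∀ x : ℝ, T ≤ x → 0 < G x)
    (hder : ∀ x : ℝ, T ≤ x → |iteratedDerivWithin (N + 1) φ (Ici 0) x| ≤ G x / x ^ (N + 1))
    (hgrow : ∀ x y : ℝ, T ≤ x → T ≤ y → G y ≤ B * G x * Real.exp (C * (|y - x| / √x))) :
    ∃ A a : ℝ, ∀ m : ℕ, |φ m| ≤ A * a ^ m := by
  have hsT := Real.sqrt_pos.2 hT
  have hGT := hG T le_rfl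
  -- A₁ serves the Taylor polynomial, A₂ the remainder, A₃ the finitely many m < T.
  set A₁ := ∑ k ∈ Finset.range (N + 1), |iteratedDerivWithin k φ (Ici 0) T| * Real.exp T with hA₁
  set A₂ := B * G T / T ^ (N + 1) * (N + 1).factorial with hA₂
  set A₃ := ∑ k ∈ Finset.range ⌈T⌉₊, |φ k| with hA₃
  have h1 : 0 ≤ A₁ := Finset.sum_nonneg fun k _ => by positivity
  have h2 : 0 ≤ A₂ := by positivity
  have h3 : 0 ≤ A₃ := Finset.sum_nonneg fun k _ => abs_nonneg _
  have hexp : ∀ m : ℕ, Real.exp (1 + C / √T) ^ m = Real.exp m * Real.exp (C * (m / √T)) := by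
    intro m
    rw [← Real.exp_nat_mul, ← Real.exp_add]
    ring_nf
  have hexp1 : ∀ m : ℕ, 1 ≤ Real.exp (C * (m / √T)) := fun m =>
    Real.one_le_exp (by positivity)
  refine ⟨A₁ + A₂ + A₃, Real.exp (1 + C / √T), fun m => ?_⟩
  rw [hexp]
  rcases lt_or_ge (m : ℝ) T with hm | hm
  · have hle : |φ m| ≤ A₃ := Finset.single_le_sum (f := fun k : ℕ => |φ k|)
      (fun k _ => abs_nonneg _) (Finset.mem_range.2 (Nat.lt_ceil.2 hm))
    refine hle.trans ?_
    have : 1 ≤ Real.exp (m : ℝ) * Real.exp (C * (m / √T)) :=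
      one_le_mul_of_one_le_of_one_le (Real.one_le_exp (Nat.cast_nonneg m)) (hexp1 m)
    nlinarith
  · have hpoly : |taylorWithinEval φ N (Ici 0) T m| ≤ A₁ * Real.exp m := by
      rw [taylor_within_apply, hA₁, Finset.sum_mul]
      refine (Finset.abs_sum_le_sum_abs _ _).trans (Finset.sum_le_sum fun k _ => ?_)
      rw [smul_eq_mul, abs_mul, abs_mul, abs_pow,
        abs_of_nonneg (by positivity : 0 ≤ (k.factorial : ℝ)⁻¹), mul_comm, mul_assoc, ← Real.exp_add]
      refine mul_le_mul_of_nonneg_left ?_ (abs_nonneg _)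
      have h := Real.pow_div_factorial_le_exp |(m : ℝ) - T| (abs_nonneg _) k
      rw [inv_mul_eq_div]
      refine h.trans (Real.exp_le_exp.2 ?_)
      rw [abs_of_nonneg (by linarith)]
      linarith
    have hrem : |φ m - taylorWithinEval φ N (Ici 0) T m| ≤
        A₂ * Real.exp m * Real.exp (C * (m / √T)) := by
      rw [sub_taylorWithinEval_eq_integral hφ hT.le (Nat.cast_nonneg m)]
      refine (abs_integral_taylor_kernel_le (L := m)
        (D := B * G T * Real.exp (C * (m / √T)) / T ^ (N + 1)) ?_ ?_).trans ?_
      · intro t ht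
        rw [uIcc_of_le hm] at ht
        refine (hder t ht.1).trans ?_
        refine div_le_div₀ (by positivity) ((hgrow T t le_rfl ht.1).trans ?_) (by positivity)
          (pow_le_pow_left₀ hT.le ht.1 _)
        rw [abs_of_nonneg (by linarith [ht.1])]
        gcongr
        linarith [ht.2]
      · intro t ht
        rw [uIcc_of_le hm] at ht
        rw [abs_of_nonneg (by linarith [ht.2])]
        linarith [ht.1]
      · rw [abs_of_nonneg (by linarith), hA₂]
        have hpow := pow_le_factorial_mul_exp (Nat.cast_nonneg (α := ℝ) m) (N + 1)
        calc B * G T * Real.exp (C * (m / √T)) / T ^ (N + 1) * (m : ℝ) ^ N * (m - T)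
            ≤ B * G T * Real.exp (C * (m / √T)) / T ^ (N + 1) * (m : ℝ) ^ N * m := by
              gcongr
              linarith
          _ = B * G T / T ^ (N + 1) * Real.exp (C * (m / √T)) * (m : ℝ) ^ (N + 1) := by ring
          _ ≤ B * G T / T ^ (N + 1) * Real.exp (C * (m / √T)) *
              ((N + 1).factorial * Real.exp m) := by gcongr
          _ = _ := by ring
    have htri : |φ m| ≤ |taylorWithinEval φ N (Ici 0) T m| +
        |φ m - taylorWithinEval φ N (Ici 0) T m| := by
      refine le_trans (le_of_eq ?_) (abs_add_le _ _)
      congr 1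
      ring
    refine htri.trans ((add_le_add hpoly hrem).trans ?_)
    have e1 : A₁ * Real.exp m ≤ A₁ * (Real.exp m * Real.exp (C * (m / √T))) := by
      gcongr
      exact le_mul_of_one_le_right (Real.exp_pos _).le (hexp1 m)
    have e3 : 0 ≤ A₃ * (Real.exp m * Real.exp (C * (m / √T))) := by positivity
    linarith

/-- The constant in the bound of the Taylor remainder. -/
noncomputable def taylorRemainderConst (N : ℕ) (B : ℝ) : ℝ :=
  B * (2 ^ (N + 1) * (N + 1).factorial + 2 ^ (5 * (N + 1)) * (5 * (N + 1)).factorial)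

-- With u = |b - R|/√R, powers of u cost only a factor e^u. For b ≥ R/2 the derivative is controlled
-- by (R/2)^{-(N+1)}. For b < R/2 only T^{-(N+1)} is available, but then u ≥ √R/2, so any power of R
-- is absorbed too. The two cases give the two summands of `taylorRemainderConst`, neither involving
-- T.
open Set in
theorem abs_sub_taylorWithinEval_le {φ G : ℝ → ℝ} {N : ℕ} {B C T M R b : ℝ} (hB : 0 < B)
    (hC : 0 < C) (hT : 0 < T) (hφ : ContDiffOn ℝ ((N + 1 : ℕ) : WithTop ℕ∞) φ (Ici 0))
    (hG : ∀ x : ℝ, T ≤ x → 0 < G x)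
    (hder : ∀ x : ℝ, T ≤ x → |iteratedDerivWithin (N + 1) φ (Ici 0) x| ≤ G x / x ^ (N + 1))
    (hgrow : ∀ x y : ℝ, T ≤ x → T ≤ y → G y ≤ B * G x * Real.exp (C * (|y - x| / √x)))
    (hM : ∀ t ∈ Icc 0 T, |iteratedDerivWithin (N + 1) φ (Ici 0) t| ≤ M)
    (hRT : 2 * T ≤ R) (hRinv : T⁻¹ ≤ R) (hb : 0 ≤ b) :
    |φ b - taylorWithinEval φ N (Ici 0) R b| ≤
      taylorRemainderConst N B * (G R / √R ^ (N + 1)) * Real.exp ((C + 1) * (|b - R| / √R)) +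
        if b < T then M * T ^ (N + 1) else 0 := by
  have hR : 0 < R := by linarith
  have hTR : T ≤ R := by linarith
  have hs : 0 < √R := Real.sqrt_pos.2 hR
  have hGR := hG R hTR
  set u := |b - R| / √R with hu
  have hu0 : 0 ≤ u := by positivity
  have hus : |b - R| = u * √R := by rw [hu]; field_simp
  have hss : √R ^ 2 = R := Real.sq_sqrt hR.le
  have hM0 : 0 ≤ M := (abs_nonneg _).trans (hM 0 ⟨le_rfl, hT.le⟩)
  have hind : (0 : ℝ) ≤ if b < T then M * T ^ (N + 1) else 0 := by split_ifs <;> positivity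
  have hψ : ∀ t c : ℝ, 0 < c → T ≤ t → c ≤ t → |t - R| ≤ |b - R| →
      |iteratedDerivWithin (N + 1) φ (Ici 0) t| ≤ B * G R * Real.exp (C * u) / c ^ (N + 1) := by
    intro t c hc hTt hct htR
    refine (hder t hTt).trans (div_le_div₀ (by positivity) ((hgrow R t hTR hTt).trans ?_)
      (by positivity) (pow_le_pow_left₀ hc.le hct _))
    gcongr
    rw [hu]
    gcongr
  have hexp : Real.exp ((C + 1) * u) = Real.exp (C * u) * Real.exp u := by
    rw [← Real.exp_add]
    ring_nf
  rw [sub_taylorWithinEval_eq_integral hφ hR.le hb]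
  rcases le_or_gt (R / 2) b with hb2 | hb2
  · have hT2 : ∀ t ∈ uIcc R b, R / 2 ≤ t := fun t ht =>
      (le_min (by linarith) hb2).trans ht.1
    have h := abs_integral_taylor_kernel_le (N := N) (b := b) (c := R) (d := b) (L := |b - R|)
      (fun t ht => hψ t (R / 2) (by positivity) (by linarith [hT2 t ht]) (hT2 t ht)
        (abs_sub_left_of_mem_uIcc ht))
      (fun t ht => abs_sub_right_of_mem_uIcc ht)
    refine (h.trans ?_).trans (le_add_of_nonneg_right hind)
    have hpow := pow_le_factorial_mul_exp hu0 (N + 1)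
    calc B * G R * Real.exp (C * u) / (R / 2) ^ (N + 1) * |b - R| ^ N * |b - R|
        = B * G R * Real.exp (C * u) * 2 ^ (N + 1) * (u ^ (N + 1) / √R ^ (N + 1)) := by
          rw [mul_assoc _ (|b - R| ^ N), ← pow_succ, hus, mul_pow, div_pow]
          have hRs : R ^ (N + 1) = √R ^ (N + 1) * √R ^ (N + 1) := by
            rw [← mul_pow, ← sq, hss]
          rw [hRs]
          field_simp
      _ ≤ B * G R * Real.exp (C * u) * 2 ^ (N + 1) *
          ((N + 1).factorial * Real.exp u / √R ^ (N + 1)) := by gcongr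
      _ = B * (2 ^ (N + 1) * (N + 1).factorial) * (G R / √R ^ (N + 1)) *
          Real.exp ((C + 1) * u) := by
          rw [hexp]
          ring
      _ ≤ _ := by
          rw [taylorRemainderConst]
          gcongr
          exact le_add_of_nonneg_right (by positivity)
  -- The bound by G holds only on [a, R]; the piece from a to b is empty unless b < T, and there M
  -- takes over.
  · set a := max b T with ha
    have hab : b ≤ a := le_max_left _ _
    have haT : T ≤ a := le_max_right _ _
    have haR : a ≤ R := max_le (by linarith) hTR
    have hcont := hφ.continuousOn_iteratedDerivWithin (m := N + 1) (by norm_cast)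
      (uniqueDiffOn_Ici 0)
    have hint : ∀ x y : ℝ, 0 ≤ x → 0 ≤ y → IntervalIntegrable (fun t =>
        ((N.factorial : ℝ)⁻¹ * (b - t) ^ N) * iteratedDerivWithin (N + 1) φ (Ici 0) t)
        MeasureTheory.volume x y := fun x y hx hy =>
      ContinuousOn.intervalIntegrable (ContinuousOn.mul (by fun_prop)
        (hcont.mono fun t ht => (le_min hx hy).trans ht.1))
    rw [← intervalIntegral.integral_add_adjacent_intervals (hint R a hR.le (hb.trans hab))
      (hint a b (hb.trans hab) hb)]
    refine (abs_add_le _ _).trans (add_le_add ?_ ?_)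
    · have h := abs_integral_taylor_kernel_le (N := N) (b := b) (c := R) (d := a) (L := R)
        (ψ := iteratedDerivWithin (N + 1) φ (Ici 0))
        (D := B * G R * Real.exp (C * u) / T ^ (N + 1))
        (fun t ht => by
          rw [uIcc_of_ge haR] at ht
          refine hψ t T hT (haT.trans ht.1) (haT.trans ht.1) ?_
          rw [abs_of_nonpos (by linarith [ht.2]), abs_of_nonpos (by linarith)]
          linarith [ht.1])
        (fun t ht => by
          rw [uIcc_of_ge haR] at ht
          rw [abs_of_nonpos (by linarith [ht.1])]
          linarith [ht.2])
      refine h.trans ?_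
      have hsu : √R ≤ 2 * u := by
        have h1 : R / 2 ≤ u * √R := by
          rw [← hus, abs_of_nonpos (by linarith)]
          linarith
        have h2 : √R * √R ≤ (2 * u) * √R := by nlinarith
        exact le_of_mul_le_mul_right h2 hs
      have hpow := pow_le_factorial_mul_exp hu0 (5 * (N + 1))
      have haR' : |a - R| ≤ R := by
        rw [abs_of_nonpos (by linarith)]
        linarith
      -- One factor R^(N+1) is the length and kernel of the integral, the other replaces T^{-(N+1)}
      -- through T⁻¹ ≤ R. Together with the desired gain √R^(N+1) they make √R^(5(N+1)).
      have hpow2 : R ^ (N + 1) * R ^ (N + 1) ≤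
          2 ^ (5 * (N + 1)) * ((5 * (N + 1)).factorial * Real.exp u) / √R ^ (N + 1) := by
        rw [le_div_iff₀ (by positivity)]
        calc R ^ (N + 1) * R ^ (N + 1) * √R ^ (N + 1) = √R ^ (5 * (N + 1)) := by
              nth_rewrite 1 2 [← hss]
              ring
          _ ≤ (2 * u) ^ (5 * (N + 1)) := by gcongr
          _ = 2 ^ (5 * (N + 1)) * u ^ (5 * (N + 1)) := mul_pow _ _ _
          _ ≤ _ := by gcongr
      calc B * G R * Real.exp (C * u) / T ^ (N + 1) * R ^ N * |a - R|
          ≤ B * G R * Real.exp (C * u) / T ^ (N + 1) * R ^ N * R := by gcongr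
        _ = B * G R * Real.exp (C * u) * (T⁻¹ ^ (N + 1) * R ^ (N + 1)) := by
            rw [inv_pow]
            ring
        _ ≤ B * G R * Real.exp (C * u) * (R ^ (N + 1) * R ^ (N + 1)) := by gcongr
        _ ≤ B * G R * Real.exp (C * u) *
            (2 ^ (5 * (N + 1)) * ((5 * (N + 1)).factorial * Real.exp u) / √R ^ (N + 1)) := by
            gcongr
        _ = B * (2 ^ (5 * (N + 1)) * (5 * (N + 1)).factorial) * (G R / √R ^ (N + 1)) *
            Real.exp ((C + 1) * u) := by
            rw [hexp]
            ring
        _ ≤ _ := by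
            rw [taylorRemainderConst]
            gcongr
            exact le_add_of_nonneg_left (by positivity)
    · split_ifs with hbT
      · have haT' : a = T := max_eq_right hbT.le
        rw [haT']
        refine (abs_integral_taylor_kernel_le (L := T) (D := M) ?_ ?_).trans ?_
        · intro t ht
          rw [uIcc_of_ge hbT.le] at ht
          exact hM t ⟨hb.trans ht.1, ht.2⟩
        · intro t ht
          rw [uIcc_of_ge hbT.le] at ht
          rw [abs_of_nonpos (by linarith [ht.1])]
          linarith [ht.2]
        · rw [abs_of_nonpos (by linarith), pow_succ, ← mul_assoc]
          gcongr
          linarith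
      · rw [show a = b from max_eq_left (not_lt.1 hbT)]
        simp

/-! ### Averaging Taylor's formula, and the final estimate. -/

theorem hasSum_poissonWeight_mul_taylorWithinEval (φ : ℝ → ℝ) (N : ℕ) (R : ℝ) :
    HasSum (fun m : ℕ => poissonWeight R m * taylorWithinEval φ N (Set.Ici 0) R m)
      (mahlerSum φ N R) := by
  refine (hasSum_sum (s := Finset.range (N + 1)) fun j _ =>
    (hasSum_poissonWeight_mul_sub_pow R j).mul_left
      (iteratedDerivWithin j φ (Set.Ici 0) R / (j.factorial : ℝ))).of_eq_of_eq (fun m => ?_) rfl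
  rw [taylor_within_apply, Finset.mul_sum]
  refine Finset.sum_congr rfl fun j _ => ?_
  rw [smul_eq_mul]
  ring

-- The second error term comes out here without the factor R^{(N+1)/2}; `corollary3` spends that
-- factor on making the constant uniform.
open Set in
theorem exists_abs_poissonMean_sub_mahlerSum_le {φ G : ℝ → ℝ} {N : ℕ} {B C T : ℝ} (hB : 0 < B)
    (hC : 0 < C) (hT : 0 < T) (hφ : ContDiffOn ℝ ((N + 1 : ℕ) : WithTop ℕ∞) φ (Ici 0))
    (hG : ∀ x : ℝ, T ≤ x → 0 < G x)
    (hder : ∀ x : ℝ, T ≤ x → |iteratedDerivWithin (N + 1) φ (Ici 0) x| ≤ G x / x ^ (N + 1))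
    (hgrow : ∀ x y : ℝ, T ≤ x → T ≤ y → G y ≤ B * G x * Real.exp (C * (|y - x| / √x))) :
    ∃ K' : ℝ, 0 ≤ K' ∧ ∀ R : ℝ, 1 ≤ R → 2 * T ≤ R → T⁻¹ ≤ R → (C + 1) ^ 2 ≤ R →
      |poissonMean φ R - mahlerSum φ N R| ≤
        taylorRemainderConst N B * (2 * Real.exp ((C + 1) ^ 2)) *
          (R ^ (-((N : ℝ) + 1) / 2) * G R) + K' * (R ^ T * Real.exp (-R)) := by
  have hcont := hφ.continuousOn_iteratedDerivWithin (m := N + 1) (by norm_cast)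
    (uniqueDiffOn_Ici 0)
  obtain ⟨M, hM⟩ := (isCompact_Icc (a := (0 : ℝ)) (b := T)).exists_bound_of_continuousOn
    (hcont.mono Icc_subset_Ici_self)
  have hM0 : 0 ≤ M := (norm_nonneg _).trans (hM 0 ⟨le_rfl, hT.le⟩)
  obtain ⟨A, a, hAa⟩ := exists_abs_le_mul_pow hB hC hT hφ hG hder hgrow
  refine ⟨M * T ^ (N + 1) * ⌈T⌉₊, by positivity, fun R hR1 hRT hRinv hRC => ?_⟩
  have hR : 0 < R := by linarith
  have hGR := hG R (by linarith)
  have hmean : HasSum (fun m : ℕ => poissonWeight R m * φ m) (poissonMean φ R) := by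
    rw [poissonMean_eq_tsum]
    exact (summable_poissonWeight_mul (summable_of_abs_le_mul_pow hAa R)).hasSum
  have hdiff := hmean.sub (hasSum_poissonWeight_mul_taylorWithinEval φ N R)
  obtain ⟨hsum, hle⟩ := poissonWeight_mul_exp_abs_sub (c := C + 1) (by linarith) hR hRC
  set q := taylorRemainderConst N B * (G R / √R ^ (N + 1)) with hq
  have hconst : 0 ≤ taylorRemainderConst N B := by
    unfold taylorRemainderConst
    positivity
  have hq0 : 0 ≤ q := by positivity
  have hfin : HasSum (fun m : ℕ => if (m : ℝ) < T then poissonWeight R m * (M * T ^ (N + 1)) else 0)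
      (∑ m ∈ Finset.range ⌈T⌉₊, poissonWeight R m * (M * T ^ (N + 1))) := by
    have h := hasSum_sum_of_ne_finset_zero (L := SummationFilter.unconditional ℕ)
      (s := Finset.range ⌈T⌉₊)
      (f := fun m : ℕ => if (m : ℝ) < T then poissonWeight R m * (M * T ^ (N + 1)) else 0)
      (fun m hm => if_neg fun h => hm (Finset.mem_range.2 (Nat.lt_ceil.2 h)))
    rwa [Finset.sum_congr rfl fun m hm => if_pos (Nat.lt_ceil.1 (Finset.mem_range.1 hm))] at h
  have hbound := hdiff.norm_le_of_bounded ((hsum.hasSum.mul_left q).add hfin) fun m => by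
    rw [← mul_sub, Real.norm_eq_abs, abs_mul, abs_of_nonneg (poissonWeight_nonneg hR.le m)]
    refine (mul_le_mul_of_nonneg_left (abs_sub_taylorWithinEval_le hB hC hT hφ hG hder hgrow
      hM hRT hRinv (Nat.cast_nonneg m)) (poissonWeight_nonneg hR.le m)).trans (le_of_eq ?_)
    rw [mul_add, mul_ite, mul_zero]
    ring
  rw [Real.norm_eq_abs] at hbound
  refine hbound.trans (add_le_add ?_ ?_)
  · have hpow : R ^ (-((N : ℝ) + 1) / 2) = (√R ^ (N + 1))⁻¹ := by
      rw [Real.sqrt_eq_rpow, ← Real.rpow_natCast, ← Real.rpow_mul hR.le, ← Real.rpow_neg hR.le]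
      push_cast
      ring_nf
    refine (mul_le_mul_of_nonneg_left hle hq0).trans (le_of_eq ?_)
    rw [hpow, hq]
    ring
  · rw [← Finset.sum_mul, mul_comm]
    refine (mul_le_mul_of_nonneg_left (sum_poissonWeight_range_le hR1)
      (by positivity)).trans (le_of_eq ?_)
    ring

theorem corollary3 :
    -- the expansion
    (∀ (N : ℕ) (B C : ℝ), 0 < B → 0 < C → ∃ K : ℝ, ∀ T : ℝ, 0 < T → ∃ R₀ : ℝ,
      ∀ φ G : ℝ → ℝ,
        ContDiffOn ℝ ((N + 1 : ℕ) : WithTop ℕ∞) φ (Set.Ici 0) →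
        (∀ x : ℝ, T ≤ x → 0 < G x) →
        (∀ x : ℝ, T ≤ x →
          |iteratedDerivWithin (N + 1) φ (Set.Ici 0) x| ≤ G x / x ^ (N + 1)) →
        (∀ x y : ℝ, T ≤ x → T ≤ y →
          G y ≤ B * G x * Real.exp (C * (|y - x| / Real.sqrt x))) →
        (∀ R : ℝ, Summable fun m : ℕ => φ m / (m.factorial : ℝ) * R ^ m) ∧
        -- with a threshold that does not depend on `φ` and `G`
        (∃ K' : ℝ, ∀ R : ℝ, R₀ ≤ R →
          |poissonMean φ R - mahlerSum φ N R| ≤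
            K * (R ^ (-((N : ℝ) + 1) / 2) * G R) +
              K' * (R ^ (T + ((N : ℝ) + 1) / 2) * Real.exp (-R))) ∧
        -- with a single constant for both error terms
        (∀ᶠ R : ℝ in Filter.atTop,
          |poissonMean φ R - mahlerSum φ N R| ≤
            K * (R ^ (-((N : ℝ) + 1) / 2) * G R +
              R ^ (T + ((N : ℝ) + 1) / 2) * Real.exp (-R)))) ∧
    -- the polynomials `ρ_j(-x)`: degree, nonnegative coefficients, first eight values
    (∀ j : ℕ, ((mahlerPolynomial j).comp (-Polynomial.X)).natDegree = j / 2) ∧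
    (∀ j i : ℕ, 0 ≤ ((mahlerPolynomial j).comp (-Polynomial.X)).coeff i) ∧
    (∀ x : ℝ,
      (mahlerPolynomial 0).eval (-x) = 1 ∧
      (mahlerPolynomial 1).eval (-x) = 0 ∧
      (mahlerPolynomial 2).eval (-x) = x ∧
      (mahlerPolynomial 3).eval (-x) = x ∧
      (mahlerPolynomial 4).eval (-x) = 3 * x ^ 2 + x ∧
      (mahlerPolynomial 5).eval (-x) = 10 * x ^ 2 + x ∧
      (mahlerPolynomial 6).eval (-x) = 15 * x ^ 3 + 25 * x ^ 2 + x ∧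
      (mahlerPolynomial 7).eval (-x) = 105 * x ^ 3 + 56 * x ^ 2 + x) := by
  refine ⟨fun N B C hB hC => ?_, mahlerPolynomial_comp_natDegree,
    mahlerPolynomial_comp_coeff_nonneg, mahlerPolynomial_eval_neg_values⟩
  -- The 1 lets the same K serve the second error term.
  set K := max 1 (taylorRemainderConst N B * (2 * Real.exp ((C + 1) ^ 2)))
  refine ⟨K, fun T hT => ⟨max (max 1 (2 * T)) (max T⁻¹ ((C + 1) ^ 2)),
    fun φ G hφ hG hder hgrow => ?_⟩⟩
  obtain ⟨K', hK', hmain⟩ := exists_abs_poissonMean_sub_mahlerSum_le hB hC hT hφ hG hder hgrow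
  have hmain' : ∀ R : ℝ, max (max 1 (2 * T)) (max T⁻¹ ((C + 1) ^ 2)) ≤ R →
      1 ≤ R ∧ |poissonMean φ R - mahlerSum φ N R| ≤
        K * (R ^ (-((N : ℝ) + 1) / 2) * G R) + K' * (R ^ T * Real.exp (-R)) := by
    intro R hR
    simp only [max_le_iff] at hR
    obtain ⟨⟨h1, h2⟩, h3, h4⟩ := hR
    have hGR := hG R (by linarith)
    refine ⟨h1, (hmain R h1 h2 h3 h4).trans ?_⟩
    gcongr
    exact le_max_right _ _
  have hsplit : ∀ R : ℝ, 1 ≤ R →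
      R ^ (T + ((N : ℝ) + 1) / 2) = R ^ (((N : ℝ) + 1) / 2) * R ^ T := fun R hR => by
    rw [Real.rpow_add (by linarith), mul_comm]
  refine ⟨fun R => ?_, ⟨K', fun R hR => ?_⟩, ?_⟩
  · obtain ⟨A, a, hAa⟩ := exists_abs_le_mul_pow hB hC hT hφ hG hder hgrow
    exact summable_of_abs_le_mul_pow hAa R
  · obtain ⟨h1, h⟩ := hmain' R hR
    refine h.trans ?_
    gcongr
    exact le_add_of_nonneg_right (by positivity)
  -- K' depends on φ, but R^{(N+1)/2} eventually exceeds it; this moves the dependence into the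
  -- threshold.
  · have hlim := (tendsto_rpow_atTop (y := ((N : ℝ) + 1) / 2) (by positivity)).eventually_ge_atTop K'
    filter_upwards [hlim, Filter.eventually_ge_atTop
      (max (max 1 (2 * T)) (max T⁻¹ ((C + 1) ^ 2)))] with R hKR hR
    obtain ⟨h1, h⟩ := hmain' R hR
    refine h.trans ?_
    rw [mul_add, hsplit R h1]
    refine add_le_add le_rfl ?_
    have hnn : 0 ≤ R ^ (((N : ℝ) + 1) / 2) * R ^ T * Real.exp (-R) := by positivity
    calc K' * (R ^ T * Real.exp (-R)) ≤ R ^ (((N : ℝ) + 1) / 2) * (R ^ T * Real.exp (-R)) := by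
          gcongr
      _ = 1 * (R ^ (((N : ℝ) + 1) / 2) * R ^ T * Real.exp (-R)) := by ring
      _ ≤ K * (R ^ (((N : ℝ) + 1) / 2) * R ^ T * Real.exp (-R)) := by
          gcongr
          exact le_max_left _ _
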